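/- \textbf{Setting.} Let $R:\mathbb R\times\mathbb R^m\to\mathbb R^m$ and $G:\mathbb R^m\to\mathbb R$ be infinitely differentiable, let $T>0$, and let $q:[0,T]\to\mathbb R^m$ solve $q'(t)=R(t,q(t))$, with the system dissipative along $q$: $\frac{d}{dt}G(q(t))=\nabla G(q(t))^TR(t,q(t))<0$ for all $t\in[0,T]$. Consider an explicit $s$-stage Runge--Kutta method with coefficients $a_{ij}$ ($a_{ij}=0$ for $j\ge i$), weights $b_j$ and $c_i=\sum_j a_{ij}$. A step of size $\Delta t$ from $q^n$ at time $t_n$ is $$q_i=q^n+\Delta t\sum_j a_{ij}R_j,\qquad R_i=R(t_n+c_i\Delta t,q_i),\qquad q^{n+1}=q^n+\Delta t\sum_j b_jR_j .$$ The method has order (at least) $p$ if, for every infinitely differentiable system in any dimension and every solution $y$ on an interval $[t_0,t_1]$, $t_0<t_1$, the step of size $\Delta t$ from $(t_0,y(t_0))$ differs from $y(t_0+\Delta t)$ by $\mathcal O(\Delta t^{p+1})$ as $\Delta t\to0^+$. Let $\nabla G_s$ be the orthogonal projection of $\nabla G(q^{n+1})$ onto $\mathcal S=\mathrm{span}(R_1,\dots,R_s)$.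 When $\nabla G_s\ne0$, the quasi-orthogonal projection method replaces $q^{n+1}$ by $$\hat q^{n+1}=q^{n+1}+\lambda_n\frac{\nabla G_s}{\|\nabla G_s\|_2},\qquad\text{where } G(\hat q^{n+1})=G(q^n)+\Delta t\sum_{i=1}^s b_i\,\nabla G(q_i)^TR_i. \tag{$*$}$$ \textbf{Theorem.} Suppose that the explicit Runge--Kutta method has order at least $p$, where $p\ge2$. Then there are $h^*>0$, $r>0$, $\rho>0$ and $C>0$ such that the following hold for every $\Delta t\in(0,h^*]$. (i) (One step.) For every $t_n\in[0,T]$ and every $q^n$ with $\|q^n-q(t_n)\|_2\le r$: $\nabla G_s\neq0$; equation $(*)$ has exactly one solution $\lambda_n$ with $|\lambda_n|\le\rho$; the system has a solution $z$ on $[t_n,t_n+\Delta t]$ with $z(t_n)=q^n$; and with this $\lambda_n$ the local error satisfies $\|\hat q^{n+1}-z(t_n+\Delta t)\|_2\le C\Delta t^{p+1}$. (ii) (Integration.) For every $N$ with $N\Delta t\le T$, $N$ steps of the projection method, each starting from the projected value of the previous one, can be carried out from $q^0=q(0)$ at time $0$, with $\nabla G_s\ne0$ and $|\lambda_n|\le\rho$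 at each step. Any values $\hat q^0=q(0),\hat q^1,\dots,\hat q^N$ so produced satisfy $\|\hat q^n-q(n\Delta t)\|_2\le r$ and $\|\hat q^n-q(n\Delta t)\|_2\le C\Delta t^{p}$ for $0\le n\le N$. In particular, the projection method is solvable for all $\Delta t\in(0,h^*]$ and its order of accuracy is at least $p$. -/

import Mathlib

open scoped ContDiff Topology

noncomputable section

/-- An explicit Runge-Kutta method with `s` stages: coefficients `a i j` with `a i j = 0` for
`j ≥ i`, and weights `b j`. -/
structure ExplicitRK (s : ℕ) where
  a : Fin s → Fin s → ℝ
  b : Fin s → ℝ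
  explicit : ∀ i j : Fin s, i ≤ j → a i j = 0

namespace ExplicitRK

variable {s : ℕ} {E : Type*}

/-- The abscissae `c i = ∑ j, a i j`. -/
def c (M : ExplicitRK s) (i : Fin s) : ℝ := ∑ j, M.a i j

section Stages

variable [AddCommGroup E] [Module ℝ E]

/-- The stage derivatives `R_i = R (t + c i * h, x + h * ∑ j, a i j * R_j)` of one step of size `h`
from the point `x` at time `t`. As the method is explicit, they are computed recursively, and only
the terms with `j < i` occur in the sum (see `stageDeriv_eq`). -/
def stageDeriv (M : ExplicitRK s) (R : ℝ → E → E) (t : ℝ) (x : E) (h : ℝ) (i : Fin s) : E :=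
  R (t + M.c i * h) (x + h • ∑ j : {j : Fin s // j < i}, M.a i j.1 • M.stageDeriv R t x h j.1)
termination_by i.val
decreasing_by exact j.2

/-- The stage values `q_i = x + h * ∑ j, a i j * R_j`. -/
def stageValue (M : ExplicitRK s) (R : ℝ → E → E) (t : ℝ) (x : E) (h : ℝ) (i : Fin s) : E :=
  x + h • ∑ j, M.a i j • M.stageDeriv R t x h j

/-- The Runge-Kutta update `x + h * ∑ j, b j * R_j`. -/
def step (M : ExplicitRK s) (R : ℝ → E → E) (t : ℝ) (x : E) (h : ℝ) : E :=
  x + h • ∑ j, M.b j • M.stageDeriv R t x h j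

/-- The stage equations hold in the usual form. -/
theorem stageDeriv_eq (M : ExplicitRK s) (R : ℝ → E → E) (t : ℝ) (x : E) (h : ℝ) (i : Fin s) :
    M.stageDeriv R t x h i = R (t + M.c i * h) (M.stageValue R t x h i) := by
  rw [stageDeriv, stageValue]
  congr 3
  rw [← Finset.sum_subtype (Finset.univ.filter (fun j => j < i)) (by simp)
    (fun j => M.a i j • M.stageDeriv R t x h j), Finset.sum_filter]
  refine Finset.sum_congr rfl fun j _ => ?_
  split_ifs with hj
  · rfl
  · rw [M.explicit i j (not_lt.mp hj), zero_smul]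

end Stages

end ExplicitRK

/-- `y` solves `y' = R (t, y)` on the closed interval `[t₀, t₁]` (one-sided derivatives at the
end points). -/
def IsSolutionOn {E : Type*} [NormedAddCommGroup E] [NormedSpace ℝ E]
    (R : ℝ → E → E) (y : ℝ → E) (t₀ t₁ : ℝ) : Prop :=
  ∀ t ∈ Set.Icc t₀ t₁, HasDerivWithinAt y (R t (y t)) (Set.Icc t₀ t₁) t

namespace ExplicitRK

variable {s m : ℕ}

/-- The method has order (at least) `p`: for every smooth system, in any dimension, the local
error after one step of size `h` from the exact solution is `O(h ^ (p + 1))` as `h → 0+`. -/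
def HasOrder (M : ExplicitRK s) (p : ℕ) : Prop :=
  ∀ (d : ℕ) (R : ℝ → EuclideanSpace ℝ (Fin d) → EuclideanSpace ℝ (Fin d)),
    ContDiff ℝ ∞ (fun z : ℝ × EuclideanSpace ℝ (Fin d) => R z.1 z.2) →
    ∀ (t₀ t₁ : ℝ) (y : ℝ → EuclideanSpace ℝ (Fin d)), t₀ < t₁ → IsSolutionOn R y t₀ t₁ →
      (fun h : ℝ => y (t₀ + h) - M.step R t₀ (y t₀) h) =O[𝓝[>] 0] fun h : ℝ => h ^ (p + 1)

/-- The subspace `𝒮` spanned by the stage derivatives. -/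
def stageSpan (M : ExplicitRK s)
    (R : ℝ → EuclideanSpace ℝ (Fin m) → EuclideanSpace ℝ (Fin m))
    (t : ℝ) (x : EuclideanSpace ℝ (Fin m)) (h : ℝ) : Submodule ℝ (EuclideanSpace ℝ (Fin m)) :=
  Submodule.span ℝ (Set.range (M.stageDeriv R t x h))

/-- `∇G_s`: the component in `𝒮` of the gradient of `G` at the Runge-Kutta update, i.e. the
orthogonal projection of that gradient onto `𝒮`. -/
def gradS (M : ExplicitRK s)
    (R : ℝ → EuclideanSpace ℝ (Fin m) → EuclideanSpace ℝ (Fin m))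
    (G : EuclideanSpace ℝ (Fin m) → ℝ)
    (t : ℝ) (x : EuclideanSpace ℝ (Fin m)) (h : ℝ) : EuclideanSpace ℝ (Fin m) :=
  (M.stageSpan R t x h).starProjection (gradient G (M.step R t x h))

/-- The point `q^{n+1} + lam * ∇G_s / ‖∇G_s‖` (used only where `∇G_s ≠ 0`). -/
def projected (M : ExplicitRK s)
    (R : ℝ → EuclideanSpace ℝ (Fin m) → EuclideanSpace ℝ (Fin m))
    (G : EuclideanSpace ℝ (Fin m) → ℝ)
    (t : ℝ) (x : EuclideanSpace ℝ (Fin m)) (h lam : ℝ) : EuclideanSpace ℝ (Fin m) :=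
  M.step R t x h + lam • (‖M.gradS R G t x h‖⁻¹ • M.gradS R G t x h)

/-- The target value `G(q^n) + h * ∑ i, b i * ∇G(q_i)ᵀ R_i`. -/
def target (M : ExplicitRK s)
    (R : ℝ → EuclideanSpace ℝ (Fin m) → EuclideanSpace ℝ (Fin m))
    (G : EuclideanSpace ℝ (Fin m) → ℝ)
    (t : ℝ) (x : EuclideanSpace ℝ (Fin m)) (h : ℝ) : ℝ :=
  G x + h * ∑ i, M.b i *
    inner ℝ (gradient G (M.stageValue R t x h i)) (M.stageDeriv R t x h i)

/-- `lam` solves the scalar projection equation of the step of size `h` from `x` at time `t`. -/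
def IsProjectionParam (M : ExplicitRK s)
    (R : ℝ → EuclideanSpace ℝ (Fin m) → EuclideanSpace ℝ (Fin m))
    (G : EuclideanSpace ℝ (Fin m) → ℝ)
    (t : ℝ) (x : EuclideanSpace ℝ (Fin m)) (h lam : ℝ) : Prop :=
  G (M.projected R G t x h lam) = M.target R G t x h

/-- `Q 0, …, Q N` is produced by `N` steps of size `h` of the quasi-orthogonal projection method
from `Q 0 = x₀` at time `0`, with projection parameters of absolute value at most `ρ`. -/
def IsProjectedRun (M : ExplicitRK s)
    (R : ℝ → EuclideanSpace ℝ (Fin m) → EuclideanSpace ℝ (Fin m))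
    (G : EuclideanSpace ℝ (Fin m) → ℝ)
    (x₀ : EuclideanSpace ℝ (Fin m)) (h ρ : ℝ) (N : ℕ)
    (Q : ℕ → EuclideanSpace ℝ (Fin m)) : Prop :=
  Q 0 = x₀ ∧ ∀ n < N,
    M.gradS R G (n * h) (Q n) h ≠ 0 ∧
    ∃ lam : ℝ, |lam| ≤ ρ ∧ M.IsProjectionParam R G (n * h) (Q n) h lam ∧
      Q (n + 1) = M.projected R G (n * h) (Q n) h lam

end ExplicitRK

end

/-!
The derivatives of a function along the integral curves of a smooth field are themselves fixed
continuous functions of the position. Taylor's formula therefore makes the `O(h ^ (p + 1))` in the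
definition of the order uniform over all solutions in a compact set.

The target value of the projection equation is the last component of the Runge-Kutta step for the
augmented system `y' = R (t, y)`, `g' = ∇G(y)ᵀ R (t, y)`, along whose solutions `g` is `G(y)`. By
the previous remark for this system, the residual of the projection equation at `lam = 0` is
`O(h ^ (p + 1))`. Since the first stage derivative `R (t, x)` lies in `𝒮`, the condition
`∇Gᵀ R ≠ 0` along `q` bounds `∇G_s` away from zero near `q`. So the projection equation is strictly
monotone in `lam` with slope bounded below, its solution is `O(h ^ (p + 1))`, and the projection
does not spoil the local error. A discrete Grönwall argument sums the local errors.
-/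

noncomputable section

open Set Filter Asymptotics

section Taylor

variable {X F : Type*} [NormedAddCommGroup X] [NormedSpace ℝ X]
  [NormedAddCommGroup F] [NormedSpace ℝ F]

theorem coeff_eq_zero_of_sum_pow_smul_isBigO {n : ℕ} {c : ℕ → F}
    (hc : (fun u : ℝ => ∑ k ∈ Finset.range n, u ^ k • c k) =O[𝓝[>] 0] fun u : ℝ => u ^ n) :
    ∀ k < n, c k = 0 := by
  intro k
  induction k using Nat.strong_induction_on with
  | _ k ih =>
  intro hk
  have hpow : ∀ j, k < j → (fun u : ℝ => u ^ j) =o[𝓝[>] 0] fun u : ℝ => u ^ k :=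
    fun j hj => (isLittleO_pow_pow hj).mono nhdsWithin_le_nhds
  have hrest : ∀ j ∈ (Finset.range n).erase k,
      (fun u : ℝ => u ^ j • c j) =o[𝓝[>] 0] fun u : ℝ => u ^ k := by
    intro j hj
    obtain ⟨hjk, hjn⟩ := Finset.mem_erase.1 hj
    rcases hjk.lt_or_gt with hlt | hgt
    · simp only [ih j hlt (Finset.mem_range.1 hjn), smul_zero, isLittleO_zero]
    · exact (IsBigO.of_bound ‖c j‖ (Eventually.of_forall fun u => by
        rw [norm_smul, mul_comm])).trans_isLittleO (hpow j hgt)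
  have hterm : (fun u : ℝ => u ^ k • c k) =o[𝓝[>] 0] fun u : ℝ => u ^ k := by
    refine ((hc.trans_isLittleO (hpow n hk)).sub (IsLittleO.sum hrest)).congr_left fun u => ?_
    rw [Finset.sum_apply, ← Finset.add_sum_erase _ _ (Finset.mem_range.2 hk), add_sub_cancel_right]
  refine norm_le_zero_iff.1 (le_of_forall_pos_le_add fun ε hε => ?_)
  obtain ⟨u, hu, hu0 : 0 < u⟩ := ((hterm.def hε).and self_mem_nhdsWithin).exists
  rw [norm_smul, mul_comm] at hu
  simpa using le_of_mul_le_mul_right hu (norm_pos_iff.2 (pow_pos hu0 k).ne')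

theorem norm_le_of_isBigO_of_iteratedDerivWithin_le {f : ℝ → F} {a b C x : ℝ} {n : ℕ}
    (hab : a < b) (hf : ContDiffOn ℝ (n + 1) f (Icc a b))
    (hC : ∀ y ∈ Icc a b, ‖iteratedDerivWithin (n + 1) f (Icc a b) y‖ ≤ C)
    (hO : (fun h => f (a + h)) =O[𝓝[>] 0] fun h : ℝ => h ^ (n + 1)) (hx : x ∈ Icc a b) :
    ‖f x‖ ≤ C * (x - a) ^ (n + 1) / n.factorial := by
  have hrem : ∀ y ∈ Icc a b,
      ‖f y - taylorWithinEval f n (Icc a b) a y‖ ≤ C * (y - a) ^ (n + 1) / n.factorial :=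
    fun y hy => taylor_mean_remainder_bound hab.le hf hy hC
  set c : ℕ → F := fun k => (k.factorial : ℝ)⁻¹ • iteratedDerivWithin k f (Icc a b) a
  have hpoly : ∀ y, taylorWithinEval f n (Icc a b) a y =
      ∑ k ∈ Finset.range (n + 1), (y - a) ^ k • c k := fun y => by
    simp only [taylor_within_apply, c, smul_smul, mul_comm]
  have hremO : (fun h => f (a + h) - taylorWithinEval f n (Icc a b) a (a + h))
      =O[𝓝[>] 0] fun h : ℝ => h ^ (n + 1) := by
    refine IsBigO.of_bound (C / n.factorial) ?_
    filter_upwards [Ioc_mem_nhdsGT (sub_pos.2 hab)] with h hh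
    have := hrem (a + h) ⟨by linarith [hh.1], by linarith [hh.2]⟩
    rwa [add_sub_cancel_left, mul_div_right_comm,
      ← Real.norm_of_nonneg (pow_nonneg hh.1.le (n + 1))] at this
  have hc : ∀ k < n + 1, c k = 0 := coeff_eq_zero_of_sum_pow_smul_isBigO <|
    (hO.sub hremO).congr_left fun h => by rw [sub_sub_cancel, hpoly, add_sub_cancel_left]
  have hzero : taylorWithinEval f n (Icc a b) a x = 0 := by
    rw [hpoly]
    exact Finset.sum_eq_zero fun k hk => by rw [hc k (Finset.mem_range.1 hk), smul_zero]
  simpa [hzero] using hrem x hx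

/-- The `k`-fold Lie derivative of `Φ` along the vector field `v`, which computes the `k`-th time
derivative of `Φ` along the integral curves of `v`. -/
def iterLieDeriv (v : X → X) (Φ : X → F) : ℕ → X → F
  | 0 => Φ
  | k + 1 => fun x => fderiv ℝ (iterLieDeriv v Φ k) x (v x)

theorem contDiff_iterLieDeriv {v : X → X} {Φ : X → F} (hv : ContDiff ℝ ∞ v)
    (hΦ : ContDiff ℝ ∞ Φ) (k : ℕ) : ContDiff ℝ ∞ (iterLieDeriv v Φ k) := by
  induction k with
  | zero => exact hΦ
  | succ k ih => exact (ih.fderiv_right (m := ∞) (by simp)).clm_apply hv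

theorem IsSolutionOn.hasDerivWithinAt_comp {R : ℝ → X → X} {γ : ℝ → X} {a b u : ℝ}
    (hγ : IsSolutionOn R γ a b) {Φ : X → F} (hΦ : Differentiable ℝ Φ) (hu : u ∈ Icc a b) :
    HasDerivWithinAt (Φ ∘ γ) (fderiv ℝ Φ (γ u) (R u (γ u))) (Icc a b) u :=
  (hΦ (γ u)).hasFDerivAt.comp_hasDerivWithinAt u (hγ u hu)

theorem IsSolutionOn.iteratedDerivWithin_comp {v : X → X} {Φ : X → F} (hv : ContDiff ℝ ∞ v)
    (hΦ : ContDiff ℝ ∞ Φ) {γ : ℝ → X} {a b : ℝ} (hab : a < b)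
    (hγ : IsSolutionOn (fun _ => v) γ a b) (k : ℕ) :
    EqOn (iteratedDerivWithin k (Φ ∘ γ) (Icc a b)) (iterLieDeriv v Φ k ∘ γ) (Icc a b) := by
  induction k with
  | zero => intro u _; rw [iteratedDerivWithin_zero]; rfl
  | succ k ih =>
    intro u hu
    rw [iteratedDerivWithin_succ, derivWithin_congr ih (ih hu)]
    exact (hγ.hasDerivWithinAt_comp ((contDiff_iterLieDeriv hv hΦ k).differentiable (by simp))
      hu).derivWithin (uniqueDiffOn_Icc hab u hu)

theorem IsSolutionOn.contDiffOn_comp {v : X → X} {Φ : X → F} (hv : ContDiff ℝ ∞ v)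
    (hΦ : ContDiff ℝ ∞ Φ) {γ : ℝ → X} {a b : ℝ} (hab : a < b)
    (hγ : IsSolutionOn (fun _ => v) γ a b) : ContDiffOn ℝ ∞ (Φ ∘ γ) (Icc a b) := by
  refine contDiffOn_of_differentiableOn_deriv (n := ⊤) fun k _ => DifferentiableOn.congr
    (fun u hu => ?_) (hγ.iteratedDerivWithin_comp hv hΦ hab k)
  exact (hγ.hasDerivWithinAt_comp ((contDiff_iterLieDeriv hv hΦ k).differentiable (by simp))
    hu).differentiableWithinAt

/-- The `(n+1)`-st derivative of `Φ ∘ γ` is a fixed continuous function of the position, hence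
bounded on `K` independently of the integral curve. -/
theorem exists_norm_comp_le_of_isBigO {v : X → X} {Φ : X → F} (hv : ContDiff ℝ ∞ v)
    (hΦ : ContDiff ℝ ∞ Φ) {K : Set X} (hK : IsCompact K) (n : ℕ) :
    ∃ C, 0 < C ∧ ∀ (γ : ℝ → X) (a b : ℝ), a < b → IsSolutionOn (fun _ => v) γ a b →
      MapsTo γ (Icc a b) K →
      ((fun h => Φ (γ (a + h))) =O[𝓝[>] 0] fun h : ℝ => h ^ (n + 1)) →
      ∀ u ∈ Icc a b, ‖Φ (γ u)‖ ≤ C * (u - a) ^ (n + 1) := by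
  obtain ⟨C, hC⟩ := hK.exists_bound_of_continuousOn
    (contDiff_iterLieDeriv hv hΦ (n + 1)).continuous.continuousOn
  refine ⟨max C 1, by positivity, fun γ a b hab hγ hγK hO u hu => ?_⟩
  have hbound : ∀ y ∈ Icc a b,
      ‖iteratedDerivWithin (n + 1) (Φ ∘ γ) (Icc a b) y‖ ≤ max C 1 := fun y hy => by
    rw [hγ.iteratedDerivWithin_comp hv hΦ hab (n + 1) hy]
    exact (hC _ (hγK hy)).trans (le_max_left _ _)
  have hnonneg : 0 ≤ max C 1 * (u - a) ^ (n + 1) :=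
    mul_nonneg (by positivity) (pow_nonneg (sub_nonneg.2 hu.1) _)
  exact (norm_le_of_isBigO_of_iteratedDerivWithin_le hab
    ((hγ.contDiffOn_comp hv hΦ hab).of_le (by exact_mod_cast le_top)) hbound hO hu).trans
    (div_le_self hnonneg (by exact_mod_cast n.factorial_pos))

end Taylor

section Compactness

variable {X Y : Type*} [PseudoMetricSpace X]

theorem exists_le_abs_of_dist_le_of_isCompact {φ : X → ℝ} (hφ : Continuous φ) {K : Set X}
    (hK : IsCompact K) (hne : ∀ z ∈ K, φ z ≠ 0) :
    ∃ δ > 0, ∃ r > 0, ∀ z ∈ K, ∀ w, dist w z ≤ r → δ ≤ |φ w| := by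
  obtain ⟨δ, hδ, hδK⟩ := hK.exists_forall_le' hφ.abs.continuousOn fun z hz => abs_pos.2 (hne z hz)
  obtain ⟨r, hr, hsub⟩ := hK.exists_cthickening_subset_open (isOpen_lt continuous_const hφ.abs)
    fun z hz => (half_lt_self hδ).trans_le (hδK z hz)
  exact ⟨δ / 2, half_pos hδ, r, hr, fun z hz w hw =>
    (hsub (Metric.closedBall_subset_cthickening hz r hw)).le⟩

theorem exists_dist_le_of_dist_le_of_isCompact [PseudoMetricSpace Y] {f : X → Y}
    (hf : Continuous f) {K : Set X} (hK : IsCompact K) {ε : ℝ} (hε : 0 < ε) :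
    ∃ δ > 0, ∀ x ∈ K, ∀ y, dist y x ≤ δ → dist (f y) (f x) ≤ ε := by
  obtain ⟨δ, hδ, hsub⟩ := Metric.mem_uniformity_dist.1 <|
    hK.uniformContinuousAt_of_continuousAt f (fun _ _ => hf.continuousAt)
      (Metric.dist_mem_uniformity hε)
  refine ⟨δ / 2, half_pos hδ, fun x hx y hy => ?_⟩
  have hxy : dist x y < δ := (dist_comm x y).trans_le hy |>.trans_lt (half_lt_self hδ)
  rw [dist_comm]
  exact le_of_lt (hsub (a := x) (b := y) hxy hx)

end Compactness

section ODE

variable {E F : Type*} [NormedAddCommGroup E] [NormedSpace ℝ E]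
  [NormedAddCommGroup F] [NormedSpace ℝ F]

theorem exists_lipschitzOnWith_of_contDiff {Φ : ℝ → E → F}
    (hΦ : ContDiff ℝ 1 fun z : ℝ × E => Φ z.1 z.2) {J : Set ℝ} (hJ : IsCompact J) {K : Set E}
    (hK : IsCompact K) : ∃ L, ∀ t ∈ J, LipschitzOnWith L (Φ t) K := by
  obtain ⟨L, hL⟩ :=
    hΦ.locallyLipschitz.locallyLipschitzOn.exists_lipschitzOnWith_of_compact (hJ.prod hK)
  exact ⟨L * 1, fun t ht =>
    hL.comp (LipschitzWith.prodMk_left t).lipschitzOnWith fun x hx => ⟨ht, hx⟩⟩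

namespace IsSolutionOn

variable {R : ℝ → E → E} {y z : ℝ → E} {a b a' b' : ℝ}

theorem mono (hy : IsSolutionOn R y a b) (ha : a ≤ a') (hb : b' ≤ b) : IsSolutionOn R y a' b' :=
  fun t ht => (hy t (Icc_subset_Icc ha hb ht)).mono (Icc_subset_Icc ha hb)

theorem continuousOn (hy : IsSolutionOn R y a b) : ContinuousOn y (Icc a b) :=
  fun t ht => (hy t ht).continuousWithinAt

theorem hasDerivWithinAt_Ici (hy : IsSolutionOn R y a b) {t : ℝ} (ht : t ∈ Ico a b) :
    HasDerivWithinAt y (R t (y t)) (Ici t) t :=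
  (hy t (Ico_subset_Icc_self ht)).mono_of_mem_nhdsWithin (Icc_mem_nhdsGE_of_mem ht)

theorem norm_sub_le_exp_mul {K : Set E} {L : NNReal}
    (hL : ∀ u ∈ Icc a b, LipschitzOnWith L (R u) K) (hab : a ≤ b)
    (hy : IsSolutionOn R y a b) (hyK : MapsTo y (Icc a b) K)
    (hz : IsSolutionOn R z a b) (hzK : MapsTo z (Icc a b) K) :
    ‖y b - z b‖ ≤ Real.exp (L * (b - a)) * ‖y a - z a‖ := by
  have hsub : Ico a b ⊆ Icc a b := Ico_subset_Icc_self
  have hdist := dist_le_of_trajectories_ODE_of_mem (fun u hu => hL u (hsub hu))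
    hy.continuousOn (fun _ => hy.hasDerivWithinAt_Ici) (fun u hu => hyK (hsub hu))
    hz.continuousOn (fun _ => hz.hasDerivWithinAt_Ici) (fun u hu => hzK (hsub hu))
    le_rfl b (right_mem_Icc.2 hab)
  rwa [dist_eq_norm, dist_eq_norm, mul_comm] at hdist

theorem norm_sub_left_le (hz : IsSolutionOn R z a b) {B ε : ℝ} (hB0 : 0 ≤ B)
    (hB : ∀ u ∈ Icc a b, ∀ x ∈ Metric.closedBall (z a) ε, ‖R u x‖ < B) (hε : B * (b - a) ≤ ε)
    {u : ℝ} (hu : u ∈ Icc a b) : ‖z u - z a‖ ≤ B * (u - a) := by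
  refine image_norm_le_of_norm_deriv_right_lt_deriv_boundary' (f := fun u => z u - z a)
    (f' := fun u => R u (z u)) (B := fun u => B * (u - a)) (B' := fun _ => B)
    (hz.continuousOn.sub continuousOn_const)
    (fun w hw => (hz.hasDerivWithinAt_Ici hw).sub_const _) (by simp) (by fun_prop)
    (fun w _ => ?_) (fun w hw hwB => hB w (Ico_subset_Icc_self hw) _ ?_) hu
  · simpa using (((hasDerivAt_id w).sub_const a).const_mul B).hasDerivWithinAt
  · rw [mem_closedBall_iff_norm, hwB]
    exact (mul_le_mul_of_nonneg_left (by linarith [hw.2]) hB0).trans hε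

end IsSolutionOn

theorem Icc_subset_cthickening {J : Set ℝ} {t h ε : ℝ} (ht : t ∈ J) (hle : h ≤ ε) :
    Icc t (t + h) ⊆ Metric.cthickening ε J := fun u hu =>
  Metric.closedBall_subset_cthickening ht ε <| by
    rw [Metric.mem_closedBall, Real.dist_eq, abs_of_nonneg] <;> linarith [hu.1, hu.2]

section Uniform

variable [ProperSpace E] {R : ℝ → E → E} {J : Set ℝ} {K : Set E}

omit [NormedSpace ℝ E] in
theorem exists_eventually_norm_lt (hR : Continuous fun z : ℝ × E => R z.1 z.2)
    (hJ : IsCompact J) (hK : IsCompact K) {ε : ℝ} (hε : 0 < ε) :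
    ∃ B > 0, ∀ᶠ h in 𝓝[>] (0 : ℝ), B * h ≤ ε ∧ ∀ t ∈ J, ∀ x ∈ K, ∀ u ∈ Icc t (t + h),
      ∀ y ∈ Metric.closedBall x ε, ‖R u y‖ < B := by
  obtain ⟨B, hB0, hB⟩ := (((hJ.cthickening (r := 1)).prod
    (hK.cthickening (r := ε))).image hR).isBounded.exists_pos_norm_lt
  refine ⟨B, hB0, ?_⟩
  filter_upwards [Ioc_mem_nhdsGT (lt_min one_pos (div_pos hε hB0))] with h ⟨_, hle⟩
  obtain ⟨hle1, hleB⟩ := le_min_iff.1 hle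
  exact ⟨(le_div_iff₀' hB0).1 hleB, fun t ht x hx u hu y hy => hB _ ⟨(u, y),
    ⟨Icc_subset_cthickening ht hle1 hu, Metric.closedBall_subset_cthickening hx ε hy⟩, rfl⟩⟩

theorem eventually_mapsTo_closedBall (hR : Continuous fun z : ℝ × E => R z.1 z.2)
    (hJ : IsCompact J) (hK : IsCompact K) {ε : ℝ} (hε : 0 < ε) :
    ∀ᶠ h in 𝓝[>] (0 : ℝ), ∀ t ∈ J, ∀ z : ℝ → E, z t ∈ K → IsSolutionOn R z t (t + h) →
      MapsTo z (Icc t (t + h)) (Metric.closedBall (z t) ε) := by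
  obtain ⟨B, hB0, hev⟩ := exists_eventually_norm_lt hR hJ hK hε
  filter_upwards [hev] with h ⟨hBh, hB⟩ t ht z hzK hz u hu
  rw [mem_closedBall_iff_norm]
  exact (hz.norm_sub_left_le hB0.le (hB t ht _ hzK) (by simpa using hBh) hu).trans
    ((mul_le_mul_of_nonneg_left (by linarith [hu.2]) hB0.le).trans hBh)

theorem eventually_exists_isSolutionOn (hR : ContDiff ℝ 1 fun z : ℝ × E => R z.1 z.2)
    (hJ : IsCompact J) (hK : IsCompact K) :
    ∀ᶠ h in 𝓝[>] (0 : ℝ), ∀ t ∈ J, ∀ x ∈ K,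
      ∃ z : ℝ → E, z t = x ∧ IsSolutionOn R z t (t + h) := by
  obtain ⟨L, hL⟩ := exists_lipschitzOnWith_of_contDiff hR (hJ.cthickening (r := 1))
    (hK.cthickening (r := 1))
  obtain ⟨B, hB0, hev⟩ := exists_eventually_norm_lt hR.continuous hJ hK one_pos
  filter_upwards [hev, Ioc_mem_nhdsGT one_pos] with h ⟨hBh, hB⟩ ⟨hh, hh1⟩ t ht x hx
  have hPL : IsPicardLindelof R (tmin := t) (tmax := t + h) ⟨t, le_rfl, by linarith⟩ x
      1 0 ⟨B, hB0.le⟩ L :=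
    { lipschitzOnWith := fun u hu => (hL u (Icc_subset_cthickening ht hh1 hu)).mono
        (Metric.closedBall_subset_cthickening hx 1)
      continuousOn := fun y _ => (hR.continuous.comp (.prodMk_left y)).continuousOn
      norm_le := fun u hu y hy => (hB t ht x hx u hu y hy).le
      mul_max_le := show B * max (t + h - t) (t - t) ≤ 1 - 0 by simpa [hh.le] using hBh }
  exact hPL.exists_eq_forall_mem_Icc_hasDerivWithinAt₀

theorem exists_eventually_norm_sub_le_exp_mul (hR : ContDiff ℝ 1 fun z : ℝ × E => R z.1 z.2)
    (hJ : IsCompact J) (hK : IsCompact K) :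
    ∃ L : NNReal, ∀ᶠ h in 𝓝[>] (0 : ℝ), ∀ t ∈ J, ∀ y z : ℝ → E, y t ∈ K → z t ∈ K →
      IsSolutionOn R y t (t + h) → IsSolutionOn R z t (t + h) →
      ‖y (t + h) - z (t + h)‖ ≤ Real.exp (L * h) * ‖y t - z t‖ := by
  obtain ⟨L, hL⟩ := exists_lipschitzOnWith_of_contDiff hR (hJ.cthickening (r := 1))
    (hK.cthickening (r := 1))
  refine ⟨L, ?_⟩
  filter_upwards [eventually_mapsTo_closedBall hR.continuous hJ hK one_pos,
    Ioc_mem_nhdsGT one_pos] with h hball ⟨hh, hh1⟩ t ht y z hyK hzK hy hz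
  have hmaps : ∀ w : ℝ → E, w t ∈ K → IsSolutionOn R w t (t + h) →
      MapsTo w (Icc t (t + h)) (Metric.cthickening 1 K) := fun w hwK hw =>
    (hball t ht w hwK hw).mono_right (Metric.closedBall_subset_cthickening hwK 1)
  simpa using IsSolutionOn.norm_sub_le_exp_mul
    (fun u hu => hL u (Icc_subset_cthickening ht hh1 hu)) (by linarith)
    hy (hmaps y hyK hy) hz (hmaps z hzK hz)

end Uniform

end ODE

section Augmented

variable {E : Type*} [NormedAddCommGroup E] [NormedSpace ℝ E]

/-- The field of the system `y' = R (t, y)`, `g' = ∇G(y)ᵀ R (t, y)`, whose second component follows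
the value of `G` along the solutions of the first. The target value of the projection equation is
the second component of a Runge-Kutta step for this system (`ExplicitRK.step_augmentedField`). -/
def augmentedField (R : ℝ → E → E) (G : E → ℝ) (t : ℝ) (y : E × ℝ) : E × ℝ :=
  (R t y.1, fderiv ℝ G y.1 (R t y.1))

variable {R : ℝ → E → E} {G : E → ℝ}

theorem contDiff_augmentedField (hR : ContDiff ℝ ∞ fun z : ℝ × E => R z.1 z.2)
    (hG : ContDiff ℝ ∞ G) :
    ContDiff ℝ ∞ fun z : ℝ × E × ℝ => augmentedField R G z.1 z.2 := by
  have hR' : ContDiff ℝ ∞ fun z : ℝ × E × ℝ => R z.1 z.2.1 :=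
    hR.comp (contDiff_fst.prodMk (contDiff_fst.comp contDiff_snd))
  have hG' : ContDiff ℝ ∞ fun z : ℝ × E × ℝ => fderiv ℝ G z.2.1 :=
    (hG.fderiv_right (m := ∞) (by simp)).comp (contDiff_fst.comp contDiff_snd)
  exact hR'.prodMk (hG'.clm_apply hR')

theorem IsSolutionOn.augmentedField (hG : Differentiable ℝ G) {z : ℝ → E} {a b : ℝ}
    (hz : IsSolutionOn R z a b) :
    IsSolutionOn (augmentedField R G) (fun u => (z u, G (z u))) a b :=
  fun u hu => (hz u hu).prodMk (hz.hasDerivWithinAt_comp hG hu)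

end Augmented

namespace ExplicitRK

variable {s : ℕ} (M : ExplicitRK s)

section Linear

variable {E F : Type*} [AddCommGroup E] [Module ℝ E] [AddCommGroup F] [Module ℝ F]
  {R : ℝ → E → E} {R' : ℝ → F → F} (π : E →ₗ[ℝ] F) (hπ : ∀ t x, π (R t x) = R' t (π x))
  (t : ℝ) (x : E) (h : ℝ)

include hπ

theorem map_stageDeriv (i : Fin s) : π (M.stageDeriv R t x h i) = M.stageDeriv R' t (π x) h i := by
  induction i using WellFoundedLT.induction with
  | ind i ih =>
    rw [stageDeriv, stageDeriv, hπ, map_add, map_smul, map_sum]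
    congr 3
    exact Finset.sum_congr rfl fun j _ => by rw [map_smul, ih j.1 j.2]

theorem map_stageValue (i : Fin s) : π (M.stageValue R t x h i) = M.stageValue R' t (π x) h i := by
  simp only [stageValue, map_add, map_smul, map_sum, M.map_stageDeriv π hπ]

theorem map_step : π (M.step R t x h) = M.step R' t (π x) h := by
  simp only [step, map_add, map_smul, map_sum, M.map_stageDeriv π hπ]

end Linear

theorem stageDeriv_zero {E : Type*} [AddCommGroup E] [Module ℝ E] (hs : 0 < s) (R : ℝ → E → E)
    (t : ℝ) (x : E) (h : ℝ) : M.stageDeriv R t x h ⟨0, hs⟩ = R t x := by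
  have ha : ∀ j, M.a ⟨0, hs⟩ j = 0 := fun j => M.explicit _ _ (Nat.zero_le _)
  rw [stageDeriv_eq]
  simp [c, stageValue, ha]

theorem apply_mem_stageSpan {m : ℕ} (hs : 0 < s)
    (R : ℝ → EuclideanSpace ℝ (Fin m) → EuclideanSpace ℝ (Fin m)) (t : ℝ)
    (x : EuclideanSpace ℝ (Fin m)) (h : ℝ) : R t x ∈ M.stageSpan R t x h :=
  Submodule.subset_span ⟨⟨0, hs⟩, M.stageDeriv_zero hs R t x h⟩

section Smooth

variable {E : Type*} [NormedAddCommGroup E] [NormedSpace ℝ E] {R : ℝ → E → E}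
  {n : WithTop ℕ∞}

theorem contDiff_stageDeriv (hR : ContDiff ℝ n fun z : ℝ × E => R z.1 z.2) (i : Fin s) :
    ContDiff ℝ n fun w : ℝ × E × ℝ => M.stageDeriv R w.1 w.2.1 w.2.2 i := by
  induction i using WellFoundedLT.induction with
  | ind i ih =>
    have hsum : ContDiff ℝ n fun w : ℝ × E × ℝ =>
        ∑ j : {j : Fin s // j < i}, M.a i j.1 • M.stageDeriv R w.1 w.2.1 w.2.2 j.1 :=
      ContDiff.sum fun j _ => contDiff_const.smul (ih j.1 j.2)
    have hstage : ContDiff ℝ n fun w : ℝ × E × ℝ => (w.1 + M.c i * w.2.2, w.2.1 + w.2.2 •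
        ∑ j : {j : Fin s // j < i}, M.a i j.1 • M.stageDeriv R w.1 w.2.1 w.2.2 j.1) := by
      fun_prop
    convert hR.comp hstage using 2 with w
    rw [stageDeriv]
    rfl

theorem contDiff_step (hR : ContDiff ℝ n fun z : ℝ × E => R z.1 z.2) :
    ContDiff ℝ n fun w : ℝ × E × ℝ => M.step R w.1 w.2.1 w.2.2 := by
  have hsum : ContDiff ℝ n fun w : ℝ × E × ℝ => ∑ j, M.b j • M.stageDeriv R w.1 w.2.1 w.2.2 j :=
    ContDiff.sum fun j _ => contDiff_const.smul (M.contDiff_stageDeriv hR j)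
  unfold step
  fun_prop

end Smooth

namespace HasOrder

variable {M} {p : ℕ}

section LocalError

variable {E : Type*} [NormedAddCommGroup E] [NormedSpace ℝ E] [FiniteDimensional ℝ E]
  {R : ℝ → E → E}

theorem isBigO (hM : M.HasOrder p) (hR : ContDiff ℝ ∞ fun z : ℝ × E => R z.1 z.2) {t₀ t₁ : ℝ}
    {y : ℝ → E} (ht : t₀ < t₁) (hy : IsSolutionOn R y t₀ t₁) :
    (fun h : ℝ => y (t₀ + h) - M.step R t₀ (y t₀) h) =O[𝓝[>] 0] fun h : ℝ => h ^ (p + 1) := by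
  have e := toEuclidean (E := E)
  set R' : ℝ → EuclideanSpace ℝ (Fin (Module.finrank ℝ E)) → _ := fun t x => e (R t (e.symm x))
  have hy' : IsSolutionOn R' (e ∘ y) t₀ t₁ := fun t htm => by
    simpa [R'] using e.hasFDerivAt.comp_hasDerivWithinAt t (hy t htm)
  have hO := hM _ R'
    (e.contDiff.comp (hR.comp (contDiff_fst.prodMk (e.symm.contDiff.comp contDiff_snd))))
    t₀ t₁ (e ∘ y) ht hy'
  refine ((e.symm.toContinuousLinearMap.isBigO_comp _ (𝓝[>] (0 : ℝ))).trans hO).congr_left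
    fun h => ?_
  have hstep : e (M.step R t₀ (y t₀) h) = M.step R' t₀ (e (y t₀)) h :=
    M.map_step (R := R) (R' := R') e.toLinearEquiv.toLinearMap (fun t x => by simp [R']) t₀ (y t₀) h
  simp [← hstep]

theorem stages_pos (hM : M.HasOrder p) (hp : 1 ≤ p) : 0 < s := by
  by_contra hs
  obtain rfl : s = 0 := by omega
  have hid : (fun h : ℝ => h) =O[𝓝[>] 0] fun h : ℝ => h ^ (p + 1) := by
    simpa [step] using hM.isBigO (R := fun _ _ : ℝ => (1 : ℝ)) contDiff_const one_pos (y := id)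
      fun t _ => hasDerivWithinAt_id t _
  have hne : ∀ᶠ h : ℝ in 𝓝[>] 0, h ≠ 0 := eventually_mem_nhdsWithin.mono fun _ hh => ne_of_gt hh
  exact isLittleO_irrefl hne.frequently
    (hid.trans_isLittleO ((isLittleO_pow_id (by omega)).mono nhdsWithin_le_nhds))

theorem exists_norm_sub_step_le (hM : M.HasOrder p)
    (hR : ContDiff ℝ ∞ fun z : ℝ × E => R z.1 z.2) {J : Set ℝ} (hJ : IsCompact J) {K : Set E}
    (hK : IsCompact K) :
    ∃ C, 0 < C ∧ ∀ (z : ℝ → E) (t h : ℝ), 0 < h → IsSolutionOn R z t (t + h) →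
      Icc t (t + h) ⊆ J → MapsTo z (Icc t (t + h)) K →
      ‖z (t + h) - M.step R t (z t) h‖ ≤ C * h ^ (p + 1) := by
  let v : (ℝ × E) × ℝ × E → (ℝ × E) × ℝ × E := fun w => (0, 1, R w.2.1 w.2.2)
  let Φ : (ℝ × E) × ℝ × E → E := fun w => w.2.2 - M.step R w.1.1 w.1.2 (w.2.1 - w.1.1)
  have hv : ContDiff ℝ ∞ v := contDiff_const.prodMk (contDiff_const.prodMk (hR.comp contDiff_snd))
  have hΦ : ContDiff ℝ ∞ Φ := (contDiff_snd.comp contDiff_snd).sub ((M.contDiff_step hR).comp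
    (g := fun w : ℝ × E × ℝ => M.step R w.1 w.2.1 w.2.2)
    (f := fun w : (ℝ × E) × ℝ × E => (w.1.1, w.1.2, w.2.1 - w.1.1)) (by fun_prop))
  obtain ⟨C, hC0, hC⟩ := exists_norm_comp_le_of_isBigO hv hΦ ((hJ.prod hK).prod (hJ.prod hK)) p
  refine ⟨C, hC0, fun z t h hh hz hzJ hzK => ?_⟩
  have hth : t < t + h := lt_add_of_pos_right t hh
  set γ : ℝ → (ℝ × E) × ℝ × E := fun u => ((t, z t), u, z u)
  have hγ : IsSolutionOn (fun _ => v) γ t (t + h) := fun u hu =>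
    (hasDerivWithinAt_const u _ (t, z t)).prodMk ((hasDerivWithinAt_id u _).prodMk (hz u hu))
  have hγK : MapsTo γ (Icc t (t + h)) ((J ×ˢ K) ×ˢ (J ×ˢ K)) := fun u hu =>
    have ht := left_mem_Icc.2 hth.le
    ⟨⟨hzJ ht, hzK ht⟩, hzJ hu, hzK hu⟩
  have hO : (fun k => Φ (γ (t + k))) =O[𝓝[>] 0] fun k : ℝ => k ^ (p + 1) := by
    simpa [Φ, γ] using hM.isBigO hR hth hz
  simpa [Φ, γ] using hC γ t (t + h) hth hγ hγK hO (t + h) (right_mem_Icc.2 hth.le)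

end LocalError

end HasOrder

section Target

variable {m : ℕ} {R : ℝ → EuclideanSpace ℝ (Fin m) → EuclideanSpace ℝ (Fin m)}
  {G : EuclideanSpace ℝ (Fin m) → ℝ}

theorem step_augmentedField (t : ℝ) (x : EuclideanSpace ℝ (Fin m)) (h : ℝ) :
    M.step (augmentedField R G) t (x, G x) h = (M.step R t x h, M.target R G t x h) := by
  have hfst : ∀ (t : ℝ) (y : EuclideanSpace ℝ (Fin m) × ℝ), LinearMap.fst ℝ _ _
      (augmentedField R G t y) = R t (LinearMap.fst ℝ _ _ y) := fun _ _ => rfl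
  have hvalue : ∀ i, (M.stageValue (augmentedField R G) t (x, G x) h i).1
      = M.stageValue R t x h i := M.map_stageValue (LinearMap.fst ℝ _ ℝ) hfst t (x, G x) h
  have hderiv : ∀ i, (M.stageDeriv (augmentedField R G) t (x, G x) h i).2
      = inner ℝ (gradient G (M.stageValue R t x h i)) (M.stageDeriv R t x h i) := fun i => by
    rw [inner_gradient_left, M.stageDeriv_eq (augmentedField R G), M.stageDeriv_eq R, ← hvalue,
      augmentedField]
  refine Prod.ext (M.map_step (LinearMap.fst ℝ _ ℝ) hfst t (x, G x) h) ?_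
  simp only [step, target, Prod.snd_add, Prod.smul_snd, Prod.snd_sum, hderiv, smul_eq_mul]

theorem HasOrder.exists_norm_sub_step_le_and_abs_sub_target_le {M : ExplicitRK s} {p : ℕ}
    (hM : M.HasOrder p)
    (hR : ContDiff ℝ ∞ fun z : ℝ × EuclideanSpace ℝ (Fin m) => R z.1 z.2)
    (hG : ContDiff ℝ ∞ G) {J : Set ℝ} (hJ : IsCompact J) {K : Set (EuclideanSpace ℝ (Fin m))}
    (hK : IsCompact K) :
    ∃ C, 0 < C ∧ ∀ (z : ℝ → EuclideanSpace ℝ (Fin m)) (t h : ℝ), 0 < h →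
      IsSolutionOn R z t (t + h) → Icc t (t + h) ⊆ J → MapsTo z (Icc t (t + h)) K →
      ‖z (t + h) - M.step R t (z t) h‖ ≤ C * h ^ (p + 1) ∧
      |G (z (t + h)) - M.target R G t (z t) h| ≤ C * h ^ (p + 1) := by
  obtain ⟨C, hC0, hC⟩ := hM.exists_norm_sub_step_le (contDiff_augmentedField hR hG) hJ
    (hK.prod (hK.image hG.continuous))
  refine ⟨C, hC0, fun z t h hh hz hzJ hzK => ?_⟩
  have herr := hC _ t h hh (hz.augmentedField (hG.differentiable (by simp))) hzJ
    fun u hu => ⟨hzK hu, mem_image_of_mem G (hzK hu)⟩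
  rw [M.step_augmentedField] at herr
  exact max_le_iff.1 herr

end Target

end ExplicitRK

section Projection

section Scalar

variable {φ φ' : ℝ → ℝ} {κ : ℝ}

theorem mul_sub_le_sub_of_le_deriv {D : Set ℝ} (hD : Convex ℝ D)
    (hφ : ∀ l ∈ D, HasDerivAt φ (φ' l) l) (hκ : ∀ l ∈ D, κ ≤ φ' l) {a b : ℝ} (ha : a ∈ D)
    (hb : b ∈ D) (hab : a ≤ b) : κ * (b - a) ≤ φ b - φ a :=
  hD.mul_sub_le_image_sub_of_le_deriv (fun l hl => (hφ l hl).continuousAt.continuousWithinAt)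
    (fun l hl => (hφ l (interior_subset hl)).differentiableAt.differentiableWithinAt)
    (fun l hl => (hκ l (interior_subset hl)).trans_eq (hφ l (interior_subset hl)).deriv.symm)
    a ha b hb hab

theorem mul_abs_sub_le_abs_sub_of_le_deriv {D : Set ℝ} (hD : Convex ℝ D)
    (hφ : ∀ l ∈ D, HasDerivAt φ (φ' l) l) (hκ : ∀ l ∈ D, κ ≤ φ' l) {a b : ℝ} (ha : a ∈ D)
    (hb : b ∈ D) : κ * |a - b| ≤ |φ a - φ b| := by
  wlog hab : b ≤ a generalizing a b
  · rw [abs_sub_comm a, abs_sub_comm (φ a)]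
    exact this hb ha (le_of_not_ge hab)
  rw [abs_of_nonneg (sub_nonneg.2 hab)]
  exact (mul_sub_le_sub_of_le_deriv hD hφ hκ hb ha hab).trans (le_abs_self _)

theorem existsUnique_abs_le_and_eq_of_le_deriv {ρ τ : ℝ} (hκ0 : 0 < κ) (hρ : 0 ≤ ρ)
    (hφ : ∀ l ∈ Icc (-ρ) ρ, HasDerivAt φ (φ' l) l) (hκ : ∀ l ∈ Icc (-ρ) ρ, κ ≤ φ' l)
    (hτ : |τ - φ 0| ≤ κ * ρ) :
    ∃! l, |l| ≤ ρ ∧ φ l = τ := by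
  have hcont : ContinuousOn φ (Icc (-ρ) ρ) := fun l hl => (hφ l hl).continuousAt.continuousWithinAt
  have hleft := mul_sub_le_sub_of_le_deriv (convex_Icc (-ρ) ρ) hφ hκ
    (show -ρ ∈ Icc (-ρ) ρ by simp [hρ]) (show 0 ∈ Icc (-ρ) ρ by simp [hρ]) (by linarith)
  have hright := mul_sub_le_sub_of_le_deriv (convex_Icc (-ρ) ρ) hφ hκ
    (show 0 ∈ Icc (-ρ) ρ by simp [hρ]) (show ρ ∈ Icc (-ρ) ρ by simp [hρ]) hρ
  obtain ⟨hτ1, hτ2⟩ := abs_le.1 hτ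
  obtain ⟨l, hl, hlτ⟩ := intermediate_value_Icc (by linarith) hcont
    (show τ ∈ Icc (φ (-ρ)) (φ ρ) by constructor <;> linarith)
  refine ⟨l, ⟨abs_le.2 hl, hlτ⟩, fun l' ⟨hl', hlτ'⟩ => ?_⟩
  have hdist := mul_abs_sub_le_abs_sub_of_le_deriv (convex_Icc (-ρ) ρ) hφ hκ (abs_le.1 hl') hl
  rw [hlτ, hlτ', sub_self, abs_zero] at hdist
  exact sub_eq_zero.1 (abs_nonpos_iff.1 (nonpos_of_mul_nonpos_right hdist hκ0))

end Scalar

variable {E : Type*} [NormedAddCommGroup E] [InnerProductSpace ℝ E]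

theorem abs_inner_le_norm_starProjection_mul (S : Submodule ℝ E) [S.HasOrthogonalProjection]
    (g : E) {v : E} (hv : v ∈ S) : |inner ℝ g v| ≤ ‖S.starProjection g‖ * ‖v‖ := by
  have hinner : inner ℝ (S.starProjection g) v = inner ℝ g v := by
    rw [S.inner_starProjection_left_eq_right, Submodule.starProjection_eq_self_iff.2 hv]
  exact hinner ▸ abs_real_inner_le_norm _ _

theorem inner_normalize_starProjection (S : Submodule ℝ E) [S.HasOrthogonalProjection] (g : E) :
    inner ℝ g (‖S.starProjection g‖⁻¹ • S.starProjection g) = ‖S.starProjection g‖ := by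
  have hinner : inner ℝ g (S.starProjection g) = ‖S.starProjection g‖ ^ 2 := by
    rw [← real_inner_self_eq_norm_sq, S.inner_starProjection_left_eq_right,
      Submodule.starProjection_eq_self_iff.2 (S.starProjection_apply_mem g)]
  rw [real_inner_smul_right, hinner, sq, ← mul_assoc, inv_mul_mul_self]

variable [CompleteSpace E] {G : E → ℝ} {S : Submodule ℝ E} [S.HasOrthogonalProjection]
  {y w : E} {κ : ℝ}

theorem le_fderiv_normalize_starProjection (hκ : 0 < κ)
    (hgrad : 2 * κ ≤ ‖S.starProjection (gradient G y)‖)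
    (hw : dist (fderiv ℝ G w) (fderiv ℝ G y) ≤ κ) :
    κ ≤ fderiv ℝ G w
      (‖S.starProjection (gradient G y)‖⁻¹ • S.starProjection (gradient G y)) := by
  set P := S.starProjection (gradient G y)
  have hunit : ‖‖P‖⁻¹ • P‖ = 1 := norm_smul_inv_norm (norm_pos_iff.1 (by linarith))
  have hslope : fderiv ℝ G y (‖P‖⁻¹ • P) = ‖P‖ := by
    rw [← inner_gradient_left, inner_normalize_starProjection]
  have hvar : |fderiv ℝ G w (‖P‖⁻¹ • P) - fderiv ℝ G y (‖P‖⁻¹ • P)| ≤ κ := by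
    rw [dist_eq_norm] at hw
    have hop := (fderiv ℝ G w - fderiv ℝ G y).le_opNorm (‖P‖⁻¹ • P)
    rw [hunit, mul_one] at hop
    exact hop.trans hw
  linarith [(abs_le.1 hvar).1]

end Projection

namespace ExplicitRK

variable {s m : ℕ} (M : ExplicitRK s)
  {R : ℝ → EuclideanSpace ℝ (Fin m) → EuclideanSpace ℝ (Fin m)}
  {G : EuclideanSpace ℝ (Fin m) → ℝ} {t h κ ρ : ℝ} {x : EuclideanSpace ℝ (Fin m)}

theorem norm_projected_sub_step (hne : M.gradS R G t x h ≠ 0) (l : ℝ) :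
    ‖M.projected R G t x h l - M.step R t x h‖ = |l| := by
  have hunit : ‖‖M.gradS R G t x h‖⁻¹ • M.gradS R G t x h‖ = 1 := norm_smul_inv_norm hne
  rw [projected, add_sub_cancel_left, norm_smul, hunit, mul_one, Real.norm_eq_abs]

theorem existsUnique_isProjectionParam (hG : Differentiable ℝ G) (hκ : 0 < κ) (hρ : 0 ≤ ρ)
    (hgrad : 2 * κ ≤ ‖M.gradS R G t x h‖)
    (hvar : ∀ w, dist w (M.step R t x h) ≤ ρ →
      dist (fderiv ℝ G w) (fderiv ℝ G (M.step R t x h)) ≤ κ)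
    (hres : |M.target R G t x h - G (M.step R t x h)| ≤ κ * ρ) :
    (∃! l, |l| ≤ ρ ∧ M.IsProjectionParam R G t x h l) ∧
    ∀ l, |l| ≤ ρ → M.IsProjectionParam R G t x h l →
      κ * ‖M.projected R G t x h l - M.step R t x h‖ ≤
        |M.target R G t x h - G (M.step R t x h)| := by
  have hne : M.gradS R G t x h ≠ 0 := norm_pos_iff.1 (by linarith)
  set e := ‖M.gradS R G t x h‖⁻¹ • M.gradS R G t x h
  have hline : ∀ l, HasDerivAt (M.projected R G t x h) e l := fun l =>
    (((hasDerivAt_id l).smul_const e).const_add (M.step R t x h)).congr_deriv (one_smul ℝ e)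
  have hderiv : ∀ l ∈ Icc (-ρ) ρ, HasDerivAt (fun l => G (M.projected R G t x h l))
      (fderiv ℝ G (M.projected R G t x h l) e) l := fun l _ =>
    (hG _).hasFDerivAt.comp_hasDerivAt l (hline l)
  have hslope : ∀ l ∈ Icc (-ρ) ρ, κ ≤ fderiv ℝ G (M.projected R G t x h l) e := fun l hl =>
    le_fderiv_normalize_starProjection hκ hgrad <| hvar _ <| by
      rw [dist_eq_norm, M.norm_projected_sub_step hne]
      exact abs_le.2 hl
  have hzero : M.projected R G t x h 0 = M.step R t x h := by rw [projected, zero_smul, add_zero]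
  refine ⟨existsUnique_abs_le_and_eq_of_le_deriv hκ hρ hderiv hslope (by rwa [hzero]),
    fun l hl hparam => ?_⟩
  have hdist := mul_abs_sub_le_abs_sub_of_le_deriv (convex_Icc (-ρ) ρ) hderiv hslope
    (abs_le.1 hl) (show (0 : ℝ) ∈ Icc (-ρ) ρ by simp [hρ])
  rwa [sub_zero, hzero, hparam, ← M.norm_projected_sub_step hne] at hdist

end ExplicitRK

theorem le_exp_mul_of_le_exp_mul_add {e : ℕ → ℝ} {N : ℕ} {a d r : ℝ} (ha : 0 ≤ a) (hd : 0 ≤ d)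
    (hzero : e 0 ≤ 0) (hsucc : ∀ n < N, e n ≤ r → e (n + 1) ≤ Real.exp a * e n + d)
    (hr : ∀ n ≤ N, n * d * Real.exp (n * a) ≤ r) :
    ∀ n ≤ N, e n ≤ n * d * Real.exp (n * a) := by
  intro n
  induction n with
  | zero => simpa using hzero
  | succ n ih =>
    intro hn
    have hen := ih (by omega)
    have hexp : 1 ≤ Real.exp (a + n * a) := Real.one_le_exp (by positivity)
    calc e (n + 1) ≤ Real.exp a * e n + d := hsucc n hn (hen.trans (hr n (by omega)))
      _ ≤ Real.exp a * (n * d * Real.exp (n * a)) + d * Real.exp (a + n * a) := by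
        gcongr
        exact le_mul_of_one_le_right hd hexp
      _ = (n + 1 : ℕ) * d * Real.exp ((n + 1 : ℕ) * a) := by
        rw [Nat.cast_succ, show (n + 1 : ℝ) * a = a + n * a by ring, Real.exp_add]
        ring

theorem eventually_mul_pow_le (C : ℝ) {k : ℕ} (hk : k ≠ 0) {ε : ℝ} (hε : 0 < ε) :
    ∀ᶠ h in 𝓝[>] (0 : ℝ), C * h ^ k ≤ ε := by
  have hlim : Tendsto (fun h : ℝ => C * h ^ k) (𝓝[>] 0) (𝓝 0) := by
    simpa [hk] using ((by fun_prop : Continuous fun h : ℝ => C * h ^ k).tendsto 0).mono_left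
      nhdsWithin_le_nhds
  exact hlim.eventually_le_const hε

namespace ExplicitRK

section OneStep

variable {s m p : ℕ} {M : ExplicitRK s}
  {R : ℝ → EuclideanSpace ℝ (Fin m) → EuclideanSpace ℝ (Fin m)}
  {G : EuclideanSpace ℝ (Fin m) → ℝ} {J : Set ℝ} {K : Set (EuclideanSpace ℝ (Fin m))}

theorem eventually_norm_step_sub_le {E : Type*} [NormedAddCommGroup E] [NormedSpace ℝ E]
    (M : ExplicitRK s) {R : ℝ → E → E} (hR : Continuous fun z : ℝ × E => R z.1 z.2)
    (hJ : IsCompact J) {K : Set E} (hK : IsCompact K) {ε : ℝ} (hε : 0 < ε) :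
    ∀ᶠ h in 𝓝[>] (0 : ℝ), ∀ t ∈ J, ∀ x ∈ K, ‖M.step R t x h - x‖ ≤ ε := by
  obtain ⟨δ, hδ, hstep⟩ := exists_dist_le_of_dist_le_of_isCompact
    (M.contDiff_step (contDiff_zero.2 hR)).continuous
    (hJ.prod (hK.prod (isCompact_singleton (x := (0 : ℝ))))) hε
  filter_upwards [Ioc_mem_nhdsGT hδ] with h ⟨hh, hhδ⟩ t ht x hx
  have hdist := hstep (t, x, 0) ⟨ht, hx, rfl⟩ (t, x, h) (by
    simpa [Prod.dist_eq, abs_of_pos hh, hδ.le] using hhδ)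
  simpa [dist_eq_norm, step] using hdist

/-- The first stage derivative `R t x` lies in `𝒮`, so `∇G_s` is at least as long as the component
of `∇G` along it. -/
theorem exists_eventually_le_norm_gradS (M : ExplicitRK s) (hs : 0 < s)
    (hR : Continuous fun z : ℝ × EuclideanSpace ℝ (Fin m) => R z.1 z.2)
    (hG : ContDiff ℝ 1 G) (hJ : IsCompact J) {q : ℝ → EuclideanSpace ℝ (Fin m)}
    (hq : ContinuousOn q J) (hne : ∀ t ∈ J, inner ℝ (gradient G (q t)) (R t (q t)) ≠ 0) :
    ∃ κ > 0, ∃ r > 0, ∀ᶠ h in 𝓝[>] (0 : ℝ), ∀ t ∈ J, ∀ x, ‖x - q t‖ ≤ r →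
      κ ≤ ‖M.gradS R G t x h‖ := by
  have hφ : Continuous fun w : ℝ × EuclideanSpace ℝ (Fin m) × EuclideanSpace ℝ (Fin m) =>
      fderiv ℝ G w.2.2 (R w.1 w.2.1) :=
    ((hG.continuous_fderiv one_ne_zero).comp (continuous_snd.comp continuous_snd)).clm_apply
      (hR.comp (continuous_fst.prodMk (continuous_fst.comp continuous_snd)))
  obtain ⟨δ, hδ, r, hr, hδr⟩ := exists_le_abs_of_dist_le_of_isCompact hφ
    (hJ.image_of_continuousOn (continuousOn_id.prodMk (hq.prodMk hq)))
    (by rintro _ ⟨t, ht, rfl⟩; simpa only [inner_gradient_left, id] using hne t ht)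
  have hK : IsCompact (Metric.cthickening (r / 2) (q '' J)) :=
    (hJ.image_of_continuousOn hq).cthickening
  obtain ⟨B, hB, hRB⟩ := ((hJ.prod hK).image hR).isBounded.exists_pos_norm_lt
  refine ⟨δ / B, by positivity, r / 2, by positivity, ?_⟩
  filter_upwards [M.eventually_norm_step_sub_le hR hJ hK (half_pos hr)] with h hstep t ht x hx
  have hxK : x ∈ Metric.cthickening (r / 2) (q '' J) :=
    Metric.closedBall_subset_cthickening (mem_image_of_mem q ht) _ (mem_closedBall_iff_norm.2 hx)
  have hyq : ‖M.step R t x h - q t‖ ≤ r := by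
    linarith [norm_sub_le_norm_sub_add_norm_sub (M.step R t x h) x (q t), hstep t ht x hxK]
  have hδle : δ ≤ |inner ℝ (gradient G (M.step R t x h)) (R t x)| := by
    rw [inner_gradient_left]
    exact hδr _ ⟨t, ht, rfl⟩ (t, x, M.step R t x h) <| max_le
      (by simpa using hr.le) (max_le (by rw [dist_eq_norm]; linarith) (by rwa [dist_eq_norm]))
  rw [div_le_iff₀ hB]
  calc δ ≤ ‖M.gradS R G t x h‖ * ‖R t x‖ :=
        hδle.trans (abs_inner_le_norm_starProjection_mul _ _ (M.apply_mem_stageSpan hs R t x h))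
    _ ≤ ‖M.gradS R G t x h‖ * B := by
        gcongr
        exact (hRB _ ⟨(t, x), ⟨ht, hxK⟩, rfl⟩).le

theorem HasOrder.exists_eventually_local_error_le (hM : M.HasOrder p)
    (hR : ContDiff ℝ ∞ fun z : ℝ × EuclideanSpace ℝ (Fin m) => R z.1 z.2)
    (hG : ContDiff ℝ ∞ G) (hJ : IsCompact J) (hK : IsCompact K) :
    ∃ C > 0, ∀ᶠ h in 𝓝[>] (0 : ℝ), ∀ t ∈ J, ∀ x ∈ K,
      |M.target R G t x h - G (M.step R t x h)| ≤ C * h ^ (p + 1) ∧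
      ∃ z, z t = x ∧ IsSolutionOn R z t (t + h) ∧
        ‖M.step R t x h - z (t + h)‖ ≤ C * h ^ (p + 1) := by
  have hK' : IsCompact (Metric.cthickening 1 K) := hK.cthickening
  obtain ⟨C, hC, hloc⟩ := hM.exists_norm_sub_step_le_and_abs_sub_target_le hR hG
    (hJ.cthickening (r := 1)) hK'
  obtain ⟨L, hL⟩ := (hG.of_le (by simp)).locallyLipschitz.locallyLipschitzOn
    |>.exists_lipschitzOnWith_of_compact hK'
  refine ⟨C * (L + 1), by positivity, ?_⟩
  filter_upwards [Ioc_mem_nhdsGT one_pos, M.eventually_norm_step_sub_le hR.continuous hJ hK one_pos,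
    eventually_exists_isSolutionOn (hR.of_le (by simp)) hJ hK,
    eventually_mapsTo_closedBall hR.continuous hJ hK one_pos] with h ⟨hh, hh1⟩ hstep hsol hball
      t ht x hx
  obtain ⟨z, rfl, hz⟩ := hsol t ht x hx
  have hzK : MapsTo z (Icc t (t + h)) (Metric.cthickening 1 K) :=
    (hball t ht z hx hz).mono_right (Metric.closedBall_subset_cthickening hx 1)
  obtain ⟨herr, htarget⟩ := hloc z t h hh hz (Icc_subset_cthickening ht hh1) hzK
  have hstepK : M.step R t (z t) h ∈ Metric.cthickening 1 K :=
    Metric.closedBall_subset_cthickening hx 1 (mem_closedBall_iff_norm.2 (hstep t ht _ hx))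
  have hG_err : |G (z (t + h)) - G (M.step R t (z t) h)| ≤ L * (C * h ^ (p + 1)) :=
    (hL.norm_sub_le (hzK (right_mem_Icc.2 (by linarith))) hstepK).trans
      (mul_le_mul_of_nonneg_left herr L.coe_nonneg)
  refine ⟨?_, z, rfl, hz, ?_⟩
  · rw [abs_sub_comm] at htarget
    linarith [abs_sub_le (M.target R G t (z t) h) (G (z (t + h))) (G (M.step R t (z t) h))]
  · rw [norm_sub_rev]
    nlinarith [mul_nonneg L.coe_nonneg (mul_nonneg hC.le (pow_nonneg hh.le (p + 1)))]

/-- Unique solvability and local accuracy of the steps of size `h` of the projection method, with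
radius `ρ` for the projection parameter and constant `C` for the local error, from all points at
distance at most `r` from the curve `q` on `[0, T]`. -/
def IsLocallyAccurate (M : ExplicitRK s)
    (R : ℝ → EuclideanSpace ℝ (Fin m) → EuclideanSpace ℝ (Fin m))
    (G : EuclideanSpace ℝ (Fin m) → ℝ) (q : ℝ → EuclideanSpace ℝ (Fin m)) (T : ℝ) (p : ℕ)
    (r ρ C h : ℝ) : Prop :=
  ∀ t ∈ Icc 0 T, ∀ x : EuclideanSpace ℝ (Fin m), ‖x - q t‖ ≤ r →
    M.gradS R G t x h ≠ 0 ∧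
    (∃! lam : ℝ, |lam| ≤ ρ ∧ M.IsProjectionParam R G t x h lam) ∧
    ∃ z : ℝ → EuclideanSpace ℝ (Fin m), z t = x ∧ IsSolutionOn R z t (t + h) ∧
      ∀ lam : ℝ, |lam| ≤ ρ → M.IsProjectionParam R G t x h lam →
        ‖M.projected R G t x h lam - z (t + h)‖ ≤ C * h ^ (p + 1)

variable {q : ℝ → EuclideanSpace ℝ (Fin m)} {T r ρ C D h : ℝ}

theorem IsLocallyAccurate.mono (hloc : M.IsLocallyAccurate R G q T p r ρ C h) (hh : 0 ≤ h)
    (hCD : C ≤ D) : M.IsLocallyAccurate R G q T p r ρ D h := fun t ht x hx =>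
  let ⟨hgrad, hparam, z, hzt, hz, herr⟩ := hloc t ht x hx
  ⟨hgrad, hparam, z, hzt, hz, fun lam hlam hlam' => (herr lam hlam hlam').trans
    (mul_le_mul_of_nonneg_right hCD (pow_nonneg hh _))⟩

theorem HasOrder.exists_eventually_isLocallyAccurate (hM : M.HasOrder p) (hs : 0 < s)
    (hR : ContDiff ℝ ∞ fun z : ℝ × EuclideanSpace ℝ (Fin m) => R z.1 z.2)
    (hG : ContDiff ℝ ∞ G) (hq : ContinuousOn q (Icc 0 T))
    (hne : ∀ t ∈ Icc 0 T, inner ℝ (gradient G (q t)) (R t (q t)) ≠ 0) :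
    ∃ r > 0, ∃ ρ > 0, ∃ C > 0, ∀ᶠ h in 𝓝[>] (0 : ℝ), M.IsLocallyAccurate R G q T p r ρ C h := by
  obtain ⟨κ, hκ, r, hr, hgrad⟩ :=
    M.exists_eventually_le_norm_gradS hs hR.continuous (hG.of_le (by simp)) isCompact_Icc hq hne
  have hK : IsCompact (Metric.cthickening r (q '' Icc 0 T)) :=
    (isCompact_Icc.image_of_continuousOn hq).cthickening
  obtain ⟨C, hC, hlocal⟩ := hM.exists_eventually_local_error_le hR hG isCompact_Icc hK
  obtain ⟨ρ, hρ, hvar⟩ := exists_dist_le_of_dist_le_of_isCompact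
    (hG.continuous_fderiv (by simp)) (hK.cthickening (r := 1)) (half_pos hκ)
  refine ⟨r, hr, ρ, hρ, C + C / (κ / 2), by positivity, ?_⟩
  filter_upwards [hgrad, hlocal,
    M.eventually_norm_step_sub_le hR.continuous isCompact_Icc hK one_pos,
    eventually_mul_pow_le C p.succ_ne_zero (mul_pos (half_pos hκ) hρ)]
    with h hgrad hlocal hstep hsmall t ht x hx
  have hxK : x ∈ Metric.cthickening r (q '' Icc 0 T) :=
    Metric.closedBall_subset_cthickening (mem_image_of_mem q ht) r (mem_closedBall_iff_norm.2 hx)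
  obtain ⟨hres, z, hzt, hz, herr⟩ := hlocal t ht x hxK
  obtain ⟨hunique, hshift⟩ := M.existsUnique_isProjectionParam (hG.differentiable (by simp))
    (half_pos hκ) hρ.le (by linarith [hgrad t ht x hx])
    (hvar _ (Metric.closedBall_subset_cthickening hxK 1
      (mem_closedBall_iff_norm.2 (hstep t ht x hxK)))) (hres.trans hsmall)
  refine ⟨norm_pos_iff.1 (hκ.trans_le (hgrad t ht x hx)), hunique, z, hzt, hz,
    fun lam hlam hparam => ?_⟩
  have hproj : ‖M.projected R G t x h lam - M.step R t x h‖ ≤ C / (κ / 2) * h ^ (p + 1) := by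
    rw [div_mul_eq_mul_div, le_div_iff₀' (half_pos hκ)]
    exact (hshift lam hlam hparam).trans hres
  linarith [norm_sub_le_norm_sub_add_norm_sub (M.projected R G t x h lam) (M.step R t x h)
    (z (t + h))]

end OneStep

section Convergence

variable {s m p : ℕ} {M : ExplicitRK s}
  {R : ℝ → EuclideanSpace ℝ (Fin m) → EuclideanSpace ℝ (Fin m)}
  {G : EuclideanSpace ℝ (Fin m) → ℝ} {q : ℝ → EuclideanSpace ℝ (Fin m)} {T r ρ C : ℝ}

theorem exists_isProjectedRun {x₀ : EuclideanSpace ℝ (Fin m)} {h : ℝ} {N : ℕ}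
    (hstep : ∀ n < N, ∀ Q, M.IsProjectedRun R G x₀ h ρ n Q →
      M.gradS R G (n * h) (Q n) h ≠ 0 ∧
        ∃ lam : ℝ, |lam| ≤ ρ ∧ M.IsProjectionParam R G (n * h) (Q n) h lam) :
    ∃ Q, M.IsProjectedRun R G x₀ h ρ N Q := by
  induction N with
  | zero => exact ⟨fun _ => x₀, rfl, by simp⟩
  | succ N ih =>
    obtain ⟨Q, hQ⟩ := ih fun n hn => hstep n (by omega)
    obtain ⟨hgrad, lam, hlam, hparam⟩ := hstep N (by omega) Q hQ
    refine ⟨Function.update Q (N + 1) (M.projected R G (N * h) (Q N) h lam), ?_, fun n hn => ?_⟩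
    · rw [Function.update_of_ne (by omega)]
      exact hQ.1
    · rw [Function.update_of_ne (by omega)]
      rcases Nat.lt_succ_iff_lt_or_eq.1 hn with hlt | rfl
      · rw [Function.update_of_ne (by omega)]
        exact hQ.2 n hlt
      · exact ⟨hgrad, lam, hlam, hparam, Function.update_self _ _ _⟩

theorem exists_eventually_norm_projected_sub_le
    (hR : ContDiff ℝ 1 fun z : ℝ × EuclideanSpace ℝ (Fin m) => R z.1 z.2)
    (hq : IsSolutionOn R q 0 T) (hr : 0 ≤ r)
    (hloc : ∀ᶠ h in 𝓝[>] (0 : ℝ), M.IsLocallyAccurate R G q T p r ρ C h) :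
    ∃ L : NNReal, ∀ᶠ h in 𝓝[>] (0 : ℝ), ∀ t ∈ Icc 0 T, t + h ≤ T → ∀ x, ‖x - q t‖ ≤ r →
      ∀ lam, |lam| ≤ ρ → M.IsProjectionParam R G t x h lam →
        ‖M.projected R G t x h lam - q (t + h)‖ ≤
          Real.exp (L * h) * ‖x - q t‖ + C * h ^ (p + 1) := by
  obtain ⟨L, hstab⟩ := exists_eventually_norm_sub_le_exp_mul hR isCompact_Icc
    ((isCompact_Icc.image_of_continuousOn hq.continuousOn).cthickening (r := r))
  refine ⟨L, ?_⟩
  filter_upwards [hloc, hstab] with h hloc hstab t ht hth x hx lam hlam hparam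
  obtain ⟨-, -, z, rfl, hz, herr⟩ := hloc t ht x hx
  have hqt : q t ∈ q '' Icc 0 T := mem_image_of_mem q ht
  have hzq := hstab t ht z q
    (Metric.closedBall_subset_cthickening hqt r (mem_closedBall_iff_norm.2 hx))
    (Metric.closedBall_subset_cthickening hqt r (Metric.mem_closedBall_self hr))
    hz (hq.mono ht.1 hth)
  linarith [herr lam hlam hparam, norm_sub_le_norm_sub_add_norm_sub
    (M.projected R G t (z t) h lam) (z (t + h)) (q (t + h))]

/-- The a priori bound keeps a run in the tube of radius `r`, where the one-step estimate that
yields this bound applies: the two are proved together by induction along the run. -/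
theorem exists_eventually_isProjectedRun_error_le (hp : p ≠ 0)
    (hR : ContDiff ℝ 1 fun z : ℝ × EuclideanSpace ℝ (Fin m) => R z.1 z.2)
    (hq : IsSolutionOn R q 0 T) (hr : 0 < r) (hC : 0 ≤ C)
    (hloc : ∀ᶠ h in 𝓝[>] (0 : ℝ), M.IsLocallyAccurate R G q T p r ρ C h) :
    ∃ D, ∀ᶠ h in 𝓝[>] (0 : ℝ), ∀ N : ℕ, N * h ≤ T → ∀ Q, M.IsProjectedRun R G (q 0) h ρ N Q →
      ∀ n ≤ N, ‖Q n - q (n * h)‖ ≤ r ∧ ‖Q n - q (n * h)‖ ≤ D * h ^ p := by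
  obtain ⟨L, hstep⟩ := exists_eventually_norm_projected_sub_le hR hq hr.le hloc
  refine ⟨C * T * Real.exp (L * T), ?_⟩
  filter_upwards [hstep, eventually_mul_pow_le (C * T * Real.exp (L * T)) hp hr,
    self_mem_nhdsWithin] with h hstep hsmall (hh : 0 < h) N hN Q ⟨hQ0, hQ⟩
  have htime : ∀ n ≤ N, (n : ℝ) * h ≤ T := fun n hn =>
    (mul_le_mul_of_nonneg_right (by exact_mod_cast hn) hh.le).trans hN
  have hbound : ∀ n ≤ N, n * (C * h ^ (p + 1)) * Real.exp (n * (L * h)) ≤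
      C * T * Real.exp (L * T) * h ^ p := fun n hn => by
    calc n * (C * h ^ (p + 1)) * Real.exp (n * (L * h))
        = C * (n * h) * Real.exp (L * (n * h)) * h ^ p := by
          rw [mul_left_comm (n : ℝ) (L : ℝ) h]
          ring
      _ ≤ C * T * Real.exp (L * T) * h ^ p := by
          have hnT := htime n hn
          have hT : 0 ≤ T := le_trans (by positivity) hnT
          gcongr
  have hsucc : ∀ n < N, ‖Q n - q (n * h)‖ ≤ r → ‖Q (n + 1) - q ((n + 1 : ℕ) * h)‖ ≤
      Real.exp (L * h) * ‖Q n - q (n * h)‖ + C * h ^ (p + 1) := fun n hn hQr => by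
    obtain ⟨-, lam, hlam, hparam, hnext⟩ := hQ n hn
    have hth : ((n + 1 : ℕ) : ℝ) * h = n * h + h := by rw [Nat.cast_succ, add_one_mul]
    rw [hnext, hth]
    exact hstep (n * h) ⟨by positivity, htime n hn.le⟩ (hth ▸ htime (n + 1) hn) _ hQr
      lam hlam hparam
  have herr := le_exp_mul_of_le_exp_mul_add (e := fun n => ‖Q n - q (n * h)‖) (by positivity)
    (by positivity) (by simp [hQ0]) hsucc fun n hn => (hbound n hn).trans hsmall
  exact fun n hn => ⟨(herr n hn).trans ((hbound n hn).trans hsmall),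
    (herr n hn).trans (hbound n hn)⟩

end Convergence

end ExplicitRK

end

theorem mainTheorem4_general {m s p : ℕ} (hp : 1 ≤ p)
    (M : ExplicitRK s) (hM : M.HasOrder p)
    (R : ℝ → EuclideanSpace ℝ (Fin m) → EuclideanSpace ℝ (Fin m))
    (hR : ContDiff ℝ ∞ (fun z : ℝ × EuclideanSpace ℝ (Fin m) => R z.1 z.2))
    (G : EuclideanSpace ℝ (Fin m) → ℝ) (hG : ContDiff ℝ ∞ G) (T : ℝ)
    (q : ℝ → EuclideanSpace ℝ (Fin m)) (hq : IsSolutionOn R q 0 T)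
    (hne : ∀ t ∈ Set.Icc 0 T, inner ℝ (gradient G (q t)) (R t (q t)) ≠ 0) :
    ∃ hstar > 0, ∃ r > 0, ∃ ρ > 0, ∃ C > 0, ∀ h : ℝ, 0 < h → h ≤ hstar →
      M.IsLocallyAccurate R G q T p r ρ C h ∧
      ∀ N : ℕ, N * h ≤ T →
        (∃ Q : ℕ → EuclideanSpace ℝ (Fin m), M.IsProjectedRun R G (q 0) h ρ N Q) ∧
        ∀ Q : ℕ → EuclideanSpace ℝ (Fin m), M.IsProjectedRun R G (q 0) h ρ N Q →
          ∀ n ≤ N, ‖Q n - q (n * h)‖ ≤ r ∧ ‖Q n - q (n * h)‖ ≤ C * h ^ p := by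
  obtain ⟨r, hr, ρ, hρ, C, hC, hloc⟩ :=
    hM.exists_eventually_isLocallyAccurate (hM.stages_pos hp) hR hG hq.continuousOn hne
  obtain ⟨D, hrun⟩ := ExplicitRK.exists_eventually_isProjectedRun_error_le (by omega)
    (hR.of_le (by simp)) hq hr hC.le hloc
  obtain ⟨hstar, hpos, hsub⟩ := mem_nhdsGT_iff_exists_Ioc_subset.1 (hloc.and hrun)
  refine ⟨hstar, hpos, r, hr, ρ, hρ, max C D, lt_max_of_lt_left hC, fun h hh hle => ?_⟩
  obtain ⟨hloc, hrun⟩ := hsub ⟨hh, hle⟩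
  refine ⟨hloc.mono hh.le (le_max_left C D), fun N hN => ⟨?_, fun Q hQ n hn => ?_⟩⟩
  · refine ExplicitRK.exists_isProjectedRun fun n hn Q hQ => ?_
    have hnT : n * h ≤ T := (mul_le_mul_of_nonneg_right (by exact_mod_cast hn.le) hh.le).trans hN
    obtain ⟨hgrad, hparam, -⟩ :=
      hloc (n * h) ⟨by positivity, hnT⟩ (Q n) (hrun n hnT Q hQ n le_rfl).1
    exact ⟨hgrad, hparam.exists⟩
  · obtain ⟨hQr, hQD⟩ := hrun N hN Q hQ n hn
    exact ⟨hQr, hQD.trans (mul_le_mul_of_nonneg_right (le_max_right C D) (by positivity))⟩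

theorem mainTheorem4 {m s p : ℕ} (hp : 2 ≤ p)
    (M : ExplicitRK s) (hM : M.HasOrder p)
    (R : ℝ → EuclideanSpace ℝ (Fin m) → EuclideanSpace ℝ (Fin m))
    (hR : ContDiff ℝ ∞ (fun z : ℝ × EuclideanSpace ℝ (Fin m) => R z.1 z.2))
    (G : EuclideanSpace ℝ (Fin m) → ℝ) (hG : ContDiff ℝ ∞ G)
    (T : ℝ) (hT : 0 < T)
    (q : ℝ → EuclideanSpace ℝ (Fin m)) (hq : IsSolutionOn R q 0 T)
    (hdiss : ∀ t ∈ Set.Icc 0 T, inner ℝ (gradient G (q t)) (R t (q t)) < 0) :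
    ∃ hstar > 0, ∃ r > 0, ∃ ρ > 0, ∃ C > 0, ∀ h : ℝ, 0 < h → h ≤ hstar →
      -- one step, from any point close to the exact solution
      (∀ t ∈ Set.Icc 0 T, ∀ x : EuclideanSpace ℝ (Fin m), ‖x - q t‖ ≤ r →
        M.gradS R G t x h ≠ 0 ∧
        (∃! lam : ℝ, |lam| ≤ ρ ∧ M.IsProjectionParam R G t x h lam) ∧
        ∃ z : ℝ → EuclideanSpace ℝ (Fin m), z t = x ∧ IsSolutionOn R z t (t + h) ∧
          ∀ lam : ℝ, |lam| ≤ ρ → M.IsProjectionParam R G t x h lam →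
            ‖M.projected R G t x h lam - z (t + h)‖ ≤ C * h ^ (p + 1)) ∧
      -- the whole integration on the time interval
      (∀ N : ℕ, N * h ≤ T →
        (∃ Q : ℕ → EuclideanSpace ℝ (Fin m), M.IsProjectedRun R G (q 0) h ρ N Q) ∧
        ∀ Q : ℕ → EuclideanSpace ℝ (Fin m), M.IsProjectedRun R G (q 0) h ρ N Q →
          ∀ n ≤ N, ‖Q n - q (n * h)‖ ≤ r ∧ ‖Q n - q (n * h)‖ ≤ C * h ^ p) :=
  mainTheorem4_general (by omega) M hM R hR G hG T q hq fun t ht => (hdiss t ht).ne
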